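/- Let $G$ be a (discrete) group. $G$ is *amenable* if it admits a left-invariant mean, i.e. a positive linear functional $m:\ell^\infty(G)\to\mathbb R$ on the space of bounded real-valued functions on $G$ with $m(1)=1$ and $m(g\cdot f)=m(f)$ for all $g\in G$ and $f\in\ell^\infty(G)$, where $(g\cdot f)(x)=f(g^{-1}x)$. The class of *elementary amenable* groups is the smallest class of groups that contains all finite groups and all abelian groups and is closed under taking subgroups, quotients, extensions, and direct unions (unions of directed families of subgroups). **Corollary 1.3.** 1. For every countable elementary amenable group $H$ there exist a finitely generated elementary amenable group $G$ and an injective homomorphism $H\to G$. 2. For every countable amenable group $H$ there exist a finitely generated amenable group $G$ and an injective homomorphism $H\to G$. -/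

import Mathlib

open scoped ENNReal

universe u

/-- Left translation on the space `ℓ^∞(G)` of bounded real functions on `G`:
`(g · f)(x) = f (g⁻¹ x)`. -/
def leftTranslate {G : Type u} [Group G] (g : G) (f : lp (fun _ : G => ℝ) ∞) :
    lp (fun _ : G => ℝ) ∞ :=
  ⟨fun x => f (g⁻¹ * x), memℓp_infty <| by
    obtain ⟨C, hC⟩ := memℓp_infty_iff.1 (lp.memℓp f)
    refine ⟨C, ?_⟩
    rintro _ ⟨x, rfl⟩
    exact hC ⟨g⁻¹ * x, rfl⟩⟩

/-- A left-invariant mean on `G`: a linear functional on `ℓ^∞(G)` which is positive, normalized,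
and invariant under left translations. -/
structure IsLeftInvariantMean {G : Type u} [Group G]
    (m : lp (fun _ : G => ℝ) ∞ →ₗ[ℝ] ℝ) : Prop where
  nonneg : ∀ f : lp (fun _ : G => ℝ) ∞, (∀ x, 0 ≤ f x) → 0 ≤ m f
  map_one : m 1 = 1
  map_leftTranslate : ∀ (g : G) (f : lp (fun _ : G => ℝ) ∞), m (leftTranslate g f) = m f

/-- A (discrete) group is amenable if it admits a left-invariant mean. -/
def IsAmenable (G : Type u) [Group G] : Prop :=
  ∃ m : lp (fun _ : G => ℝ) ∞ →ₗ[ℝ] ℝ, IsLeftInvariantMean m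

/-- Elementary amenable groups: the smallest class of groups that contains all finite groups and
all abelian groups and is closed under taking subgroups, quotients, extensions, and direct unions.
Subgroups and quotients are expressed through injective and surjective homomorphisms, so the class
is closed under isomorphism. -/
inductive IsElementaryAmenable : (G : Type u) → [Group G] → Prop
  | of_finite (G : Type u) [Group G] (h : Finite G) : IsElementaryAmenable G
  | of_comm (G : Type u) [Group G] (h : ∀ a b : G, a * b = b * a) : IsElementaryAmenable G
  | of_injective (G K : Type u) [Group G] [Group K] (φ : K →* G) (hφ : Function.Injective φ)
      (h : IsElementaryAmenable G) : IsElementaryAmenable K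
  | of_surjective (G Q : Type u) [Group G] [Group Q] (φ : G →* Q) (hφ : Function.Surjective φ)
      (h : IsElementaryAmenable G) : IsElementaryAmenable Q
  | of_extension (G : Type u) [Group G] (N : Subgroup G) [N.Normal]
      (hN : IsElementaryAmenable N) (hQ : IsElementaryAmenable (G ⧸ N)) : IsElementaryAmenable G
  | of_directedUnion (G : Type u) [Group G] (S : Set (Subgroup G)) (hdir : DirectedOn (· ≤ ·) S)
      (hS : ∀ K ∈ S, IsElementaryAmenable K) (hunion : ∀ g : G, ∃ K ∈ S, g ∈ K) :
      IsElementaryAmenable G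

/-! Both classes contain the abelian groups and are closed under subgroups, extensions and directed
unions; the embedding uses nothing else (`IsExtensionClosedClass`). For amenability, abelian groups
are handled by Cesàro averages of translations, and directed unions by a Hahn-Banach criterion.

The embedding uses two wreath products with ℤ. In the unrestricted wreath product of H by ℤ, the
function with value h at 0 and 1 elsewhere is the quotient of a step function by its shift, hence a
commutator [a_h, s] with s independent of h. This puts H in a group K of the class.

Now let f : ℤ → K take the value s at 1 and the values a_h at the higher powers of 3, and let G be
generated by f and the shift. A nonzero difference of two powers of 3 determines both, so distinct
translates of f overlap in at most one point and their commutator lives there. Hence G contains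
every [a_h, s] placed at 0. The base part of G is abelian modulo finitely supported functions, and
these form a group in the class, so G is in the class. -/

section Amenability

/-! ### States on bounded functions -/

/-- Precomposition of bounded functions with a map, as a linear map. -/
def boundedComp {X Y : Type*} (φ : X → Y) :
    lp (fun _ : Y => ℝ) ∞ →ₗ[ℝ] lp (fun _ : X => ℝ) ∞ where
  toFun f := ⟨fun x => f (φ x), memℓp_infty <| by
    obtain ⟨C, hC⟩ := memℓp_infty_iff.1 (lp.memℓp f)
    refine ⟨C, ?_⟩
    rintro _ ⟨x, rfl⟩
    exact hC ⟨φ x, rfl⟩⟩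
  map_add' _ _ := rfl
  map_smul' _ _ := rfl

@[simp]
theorem boundedComp_apply {X Y : Type*} (φ : X → Y) (f : lp (fun _ : Y => ℝ) ∞) (x : X) :
    boundedComp φ f x = f (φ x) := rfl

@[simp]
theorem leftTranslate_apply {G : Type*} [Group G] (g : G) (f : lp (fun _ : G => ℝ) ∞) (x : G) :
    leftTranslate g f x = f (g⁻¹ * x) := rfl

@[simp]
theorem bounded_one_apply {X : Type*} (x : X) : (1 : lp (fun _ : X => ℝ) ∞) x = 1 := rfl

/-- A positive unital linear functional on bounded functions. -/
structure IsState {X : Type*} (μ : lp (fun _ : X => ℝ) ∞ →ₗ[ℝ] ℝ) : Prop where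
  nonneg : ∀ f : lp (fun _ : X => ℝ) ∞, (∀ x, 0 ≤ f x) → 0 ≤ μ f
  map_one : μ 1 = 1

namespace IsState

variable {X Y : Type*} {μ : lp (fun _ : X => ℝ) ∞ →ₗ[ℝ] ℝ}

theorem le_of_forall_le (hμ : IsState μ) {f : lp (fun _ : X => ℝ) ∞} {c : ℝ}
    (h : ∀ x, c ≤ f x) : c ≤ μ f := by
  have h1 : 0 ≤ μ (f - c • 1) := hμ.nonneg _ fun x => by
    rw [lp.coeFn_sub, lp.coeFn_smul, Pi.sub_apply, Pi.smul_apply, bounded_one_apply, smul_eq_mul,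
      mul_one, sub_nonneg]
    exact h x
  simpa [hμ.map_one] using h1

theorem abs_le (hμ : IsState μ) {f : lp (fun _ : X => ℝ) ∞} {c : ℝ}
    (h : ∀ x, |f x| ≤ c) : |μ f| ≤ c := by
  rw [_root_.abs_le]
  refine ⟨hμ.le_of_forall_le fun x => (_root_.abs_le.1 (h x)).1, ?_⟩
  have h1 : -c ≤ μ (-f) := hμ.le_of_forall_le fun x => by
    simpa using (_root_.abs_le.1 (h x)).2
  simpa using h1

theorem comp_boundedComp (hμ : IsState μ) (φ : X → Y) : IsState (μ ∘ₗ boundedComp φ) where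
  nonneg _ hf := hμ.nonneg _ fun x => hf (φ x)
  map_one := hμ.map_one

end IsState

theorem IsLeftInvariantMean.isState {G : Type*} [Group G] {m : lp (fun _ : G => ℝ) ∞ →ₗ[ℝ] ℝ}
    (hm : IsLeftInvariantMean m) : IsState m :=
  ⟨hm.nonneg, hm.map_one⟩

/-! ### Coboundaries and the Hahn-Banach criterion -/

/-- The span of the differences between bounded functions and their translates by elements of
a set `A`. -/
noncomputable def coboundaries {G : Type*} [Group G] (A : Set G) : Submodule ℝ (lp (fun _ : G => ℝ) ∞) :=
  Submodule.span ℝ {d | ∃ g ∈ A, ∃ f, d = f - leftTranslate g f}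

theorem coboundaries_mono {G : Type*} [Group G] {A B : Set G} (h : A ⊆ B) :
    coboundaries A ≤ coboundaries B :=
  Submodule.span_mono fun _ ⟨g, hg, f, hf⟩ => ⟨g, h hg, f, hf⟩

theorem LinearMap.eq_zero_of_bddBelow {E : Type*} [AddCommGroup E] [Module ℝ E] (φ : E →ₗ[ℝ] ℝ)
    {p : Submodule ℝ E} {c : ℝ} (h : ∀ d ∈ p, c ≤ φ d) {d : E} (hd : d ∈ p) : φ d = 0 := by
  by_contra hne
  have h1 := h _ (p.smul_mem ((c - 1) / φ d) hd)
  rw [map_smul, smul_eq_mul, div_mul_cancel₀ _ hne] at h1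
  linarith

/-- A form of Dixmier's criterion. -/
theorem isAmenable_of_states {G : Type u} [Group G]
    (h : ∀ d ∈ coboundaries (Set.univ : Set G), ∀ ε > 0, ∃ μ, IsState μ ∧ μ d < ε) :
    IsAmenable G := by
  -- A coboundary `d` with `‖d - 1‖ < 1` would be at least `1 - ‖d - 1‖ > 0` everywhere, and so
  -- would its value under every state. The separating `φ` is negative at 1; dividing by `φ 1` gives
  -- the mean.
  obtain ⟨φ, c, hφ, hc⟩ := geometric_hahn_banach_open
    (convex_ball (1 : lp (fun _ : G => ℝ) ∞) 1) Metric.isOpen_ball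
    (coboundaries (Set.univ : Set G)).convex (by
      rw [Set.disjoint_left]
      intro d hd hd'
      rw [mem_ball_iff_norm] at hd
      obtain ⟨μ, hμ, hlt⟩ := h d hd' (1 - ‖d - 1‖) (by linarith)
      refine hlt.not_ge (hμ.le_of_forall_le fun x => ?_)
      have h1 := lp.norm_apply_le_norm ENNReal.top_ne_zero (d - 1) x
      have h2 := (_root_.abs_le.1 h1).1
      simp only [lp.coeFn_sub, Pi.sub_apply, bounded_one_apply] at h2
      linarith)
  have hzero : ∀ d ∈ coboundaries (Set.univ : Set G), φ d = 0 := fun d hd =>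
    LinearMap.eq_zero_of_bddBelow (φ : lp (fun _ : G => ℝ) ∞ →ₗ[ℝ] ℝ) hc hd
  have hc0 : c ≤ 0 := by simpa using hc 0 (Submodule.zero_mem _)
  have hneg : ∀ f ∈ Metric.ball (1 : lp (fun _ : G => ℝ) ∞) 1, φ f < 0 := fun f hf =>
    (hφ f hf).trans_le hc0
  have h1 : φ 1 < 0 := hneg 1 (by simp)
  have hnonpos : ∀ f : lp (fun _ : G => ℝ) ∞, (∀ x, 0 ≤ f x) → φ f ≤ 0 := by
    intro f hf
    -- For `f ≥ 0`, scaling `δ + f` by `(δ + ‖f‖)⁻¹` lands in the open unit ball about 1, where `φ <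
    -- 0`.
    have key : ∀ δ : ℝ, 0 < δ → φ f ≤ δ * -φ 1 := by
      intro δ hδ
      have hpos : 0 < δ + ‖f‖ := by positivity
      have h2 : φ ((δ + ‖f‖)⁻¹ • (δ • 1 + f)) < 0 := by
        refine hneg _ (mem_ball_iff_norm.2 ?_)
        have h3 : ‖(δ + ‖f‖)⁻¹ • (δ • 1 + f) - 1‖ ≤ ‖f‖ / (δ + ‖f‖) := by
          refine lp.norm_le_of_forall_le (by positivity) fun x => ?_
          have h4 := lp.norm_apply_le_norm ENNReal.top_ne_zero f x
          rw [Real.norm_of_nonneg (hf x)] at h4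
          have h5 := hf x
          have h6 : ((δ + ‖f‖)⁻¹ • (δ • 1 + f) - 1 : lp (fun _ : G => ℝ) ∞) x
              = -((‖f‖ - f x) / (δ + ‖f‖)) := by
            simp only [lp.coeFn_sub, lp.coeFn_smul, lp.coeFn_add, Pi.sub_apply, Pi.smul_apply,
              Pi.add_apply, bounded_one_apply, smul_eq_mul]
            field_simp
            ring
          rw [h6, norm_neg, Real.norm_of_nonneg (div_nonneg (by linarith) hpos.le)]
          gcongr
          linarith
        refine h3.trans_lt ?_
        rw [div_lt_one hpos]
        linarith
      rw [map_smul, smul_eq_mul, map_add, map_smul, smul_eq_mul] at h2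
      have := (pos_iff_neg_of_mul_neg h2).1 (inv_pos.2 hpos)
      linarith
    by_contra! hcon
    have := key (φ f / (2 * -φ 1)) (div_pos hcon (by linarith))
    have h7 : φ f / (2 * -φ 1) * -φ 1 = φ f / 2 := by
      field_simp [h1.ne]
    linarith
  refine ⟨(φ 1)⁻¹ • (φ : lp (fun _ : G => ℝ) ∞ →ₗ[ℝ] ℝ), fun f hf => ?_, ?_, fun g f => ?_⟩
  · exact mul_nonneg_of_nonpos_of_nonpos (inv_nonpos.2 h1.le) (hnonpos f hf)
  · exact inv_mul_cancel₀ h1.ne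
  · have := hzero _ (Submodule.subset_span ⟨g, trivial, f, rfl⟩)
    rw [map_sub, sub_eq_zero] at this
    simp [this]

/-! ### Closure properties of amenability -/

theorem IsAmenable.of_injective {G K : Type u} [Group G] [Group K] (φ : K →* G)
    (hφ : Function.Injective φ) (h : IsAmenable G) : IsAmenable K := by
  obtain ⟨m, hm⟩ := h
  -- Representatives of the right cosets of the image give a `K`-equivariant map `ρ : G → K`, along
  -- which the mean is pushed forward.
  have hrep : ∀ x : G, ∃ k : K,
      φ k = x * (Quotient.out (Quotient.mk (QuotientGroup.rightRel φ.range) x))⁻¹ := fun x =>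
    QuotientGroup.rightRel_apply.1 (Quotient.mk_out (s := QuotientGroup.rightRel φ.range) x)
  choose ρ hρ using hrep
  have hequiv : ∀ k x, ρ (φ k * x) = k * ρ x := by
    intro k x
    apply hφ
    have : Quotient.mk (QuotientGroup.rightRel φ.range) (φ k * x) =
        Quotient.mk (QuotientGroup.rightRel φ.range) x :=
      Quotient.sound (QuotientGroup.rightRel_apply.2 ⟨k⁻¹, by simp⟩)
    rw [map_mul, hρ, hρ, this, mul_assoc]
  have hs := hm.isState.comp_boundedComp ρ
  refine ⟨m ∘ₗ boundedComp ρ, hs.nonneg, hs.map_one, fun k f => ?_⟩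
  have : boundedComp ρ (leftTranslate k f) = leftTranslate (φ k) (boundedComp ρ f) := by
    ext x
    simp [← map_inv, hequiv]
  rw [LinearMap.comp_apply, this, hm.map_leftTranslate, LinearMap.comp_apply]

/-- Averaging `f` over each coset of `N` does not depend on the chosen representative, by invariance
of `m`; the resulting function on the quotient is then averaged by `q`. -/
theorem IsAmenable.of_extension {G : Type u} [Group G] (N : Subgroup G) [N.Normal]
    (hN : IsAmenable N) (hQ : IsAmenable (G ⧸ N)) : IsAmenable G := by
  obtain ⟨m, hm⟩ := hN
  obtain ⟨q, hq⟩ := hQ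
  have hcoset : ∀ (f : lp (fun _ : G => ℝ) ∞) (a : G) (n : N),
      m (boundedComp (fun k : N => a * n * k) f) = m (boundedComp (fun k : N => a * k) f) := by
    intro f a n
    rw [← hm.map_leftTranslate n⁻¹ (boundedComp (fun k : N => a * k) f)]
    congr 1
    ext k
    simp [mul_assoc]
  let E : lp (fun _ : G => ℝ) ∞ →ₗ[ℝ] lp (fun _ : G ⧸ N => ℝ) ∞ :=
    { toFun f := ⟨fun a => m (boundedComp (fun k : N => a.out * k) f), memℓp_infty <| by
        refine ⟨‖f‖, ?_⟩
        rintro _ ⟨a, rfl⟩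
        exact hm.isState.abs_le fun k => lp.norm_apply_le_norm ENNReal.top_ne_zero f _⟩
      map_add' f g := by
        ext a
        simp only [map_add, lp.coeFn_add, Pi.add_apply]
      map_smul' c f := by
        ext a
        simp only [map_smul, lp.coeFn_smul, Pi.smul_apply, RingHom.id_apply] }
  have hE : ∀ f a, E f a = m (boundedComp (fun k : N => a.out * k) f) := fun _ _ => rfl
  have hE' : ∀ f (a : G), E f a = m (boundedComp (fun k : N => a * k) f) := by
    intro f a
    obtain ⟨n, hn⟩ := QuotientGroup.mk_out_eq_mul N a
    rw [hE, hn, hcoset]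
  refine ⟨q ∘ₗ E, fun f hf => ?_, ?_, fun g f => ?_⟩
  · exact hq.nonneg _ fun a => hm.nonneg _ fun k => hf _
  · rw [LinearMap.comp_apply, ← hq.map_one]
    congr 1
    ext a
    exact hm.map_one
  · rw [LinearMap.comp_apply, LinearMap.comp_apply, ← hq.map_leftTranslate (g : G ⧸ N) (E f)]
    congr 1
    ext a
    obtain ⟨a, rfl⟩ := QuotientGroup.mk_surjective a
    rw [hE', leftTranslate_apply, ← QuotientGroup.mk_inv, ← QuotientGroup.mk_mul, hE']
    congr 1
    ext k
    simp [mul_assoc]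

/-- A coboundary involves finitely many translations, all by elements of one `K ∈ S`; the mean of
`K`, applied to restrictions to `K`, kills it. -/
theorem IsAmenable.of_directedUnion {G : Type u} [Group G] (S : Set (Subgroup G))
    (hdir : DirectedOn (· ≤ ·) S) (hS : ∀ K ∈ S, IsAmenable K)
    (hunion : ∀ g : G, ∃ K ∈ S, g ∈ K) : IsAmenable G := by
  refine isAmenable_of_states fun d hd ε hε => ?_
  have hex : ∃ K ∈ S, d ∈ coboundaries (K : Set G) := by
    refine Submodule.span_induction ?_ ?_ ?_ ?_ hd
    · rintro _ ⟨g, -, f, rfl⟩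
      obtain ⟨K, hK, hg⟩ := hunion g
      exact ⟨K, hK, Submodule.subset_span ⟨g, hg, f, rfl⟩⟩
    · obtain ⟨K, hK, -⟩ := hunion 1
      exact ⟨K, hK, Submodule.zero_mem _⟩
    · rintro x y - - ⟨K, hK, hx⟩ ⟨L, hL, hy⟩
      obtain ⟨M, hM, hKM, hLM⟩ := hdir K hK L hL
      exact ⟨M, hM, Submodule.add_mem _ (coboundaries_mono hKM hx) (coboundaries_mono hLM hy)⟩
    · rintro c x - ⟨K, hK, hx⟩
      exact ⟨K, hK, Submodule.smul_mem _ c hx⟩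
  obtain ⟨K, hK, hdK⟩ := hex
  obtain ⟨m, hm⟩ := hS K hK
  refine ⟨_, hm.isState.comp_boundedComp (Subtype.val : K → G), lt_of_eq_of_lt ?_ hε⟩
  rw [← LinearMap.mem_ker]
  refine Submodule.span_le.2 ?_ hdK
  rintro _ ⟨g, hg, f, rfl⟩
  have : boundedComp (Subtype.val : K → G) (leftTranslate g f) =
      leftTranslate (⟨g, hg⟩ : K) (boundedComp Subtype.val f) := rfl
  simp only [SetLike.mem_coe, LinearMap.mem_ker, LinearMap.comp_apply, map_sub, this,
    hm.map_leftTranslate, sub_self]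

/-! ### Markov operators and abelian groups -/

/-- A positive unital operator on bounded functions. -/
structure IsMarkov {X : Type*} (T : Module.End ℝ (lp (fun _ : X => ℝ) ∞)) : Prop where
  nonneg : ∀ f : lp (fun _ : X => ℝ) ∞, (∀ x, 0 ≤ f x) → ∀ x, 0 ≤ T f x
  map_one : T 1 = 1

namespace IsMarkov

variable {X : Type*} {T T' : Module.End ℝ (lp (fun _ : X => ℝ) ∞)}

theorem one : IsMarkov (1 : Module.End ℝ (lp (fun _ : X => ℝ) ∞)) := ⟨fun _ h => h, rfl⟩

theorem mul (h : IsMarkov T) (h' : IsMarkov T') : IsMarkov (T * T') :=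
  ⟨fun f hf => h.nonneg _ (h'.nonneg f hf), by rw [Module.End.mul_apply, h'.map_one, h.map_one]⟩

theorem pow (h : IsMarkov T) (n : ℕ) : IsMarkov (T ^ n) := by
  induction n with
  | zero => exact one
  | succ n ih => rw [pow_succ]; exact ih.mul h

theorem average (h : IsMarkov T) (n : ℕ) :
    IsMarkov ((n + 1 : ℝ)⁻¹ • ∑ i ∈ Finset.range (n + 1), T ^ i) where
  nonneg f hf x := by
    rw [LinearMap.smul_apply, LinearMap.sum_apply, lp.coeFn_smul, lp.coeFn_sum, Pi.smul_apply,
      Finset.sum_apply]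
    exact mul_nonneg (by positivity) (Finset.sum_nonneg fun i _ => (h.pow i).nonneg f hf x)
  map_one := by
    rw [LinearMap.smul_apply, LinearMap.sum_apply, Finset.sum_congr rfl fun i _ => (h.pow i).map_one,
      Finset.sum_const, Finset.card_range, ← Nat.cast_smul_eq_nsmul ℝ, smul_smul]
    push_cast
    rw [inv_mul_cancel₀ (by positivity), one_smul]

/-- Evaluation of a positive unital operator at a point. -/
theorem exists_state (h : IsMarkov T) (x : X) : ∃ μ, IsState μ ∧ ∀ f, μ f = T f x :=
  ⟨{ toFun f := T f x
     map_add' f g := by simp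
     map_smul' c f := by simp }, ⟨fun f hf => h.nonneg f hf x, by
      change T 1 x = 1
      rw [h.map_one]; rfl⟩, fun _ => rfl⟩

theorem abs_le (h : IsMarkov T) {f : lp (fun _ : X => ℝ) ∞} {c : ℝ} (hf : ∀ x, |f x| ≤ c) (x : X) :
    |T f x| ≤ c := by
  obtain ⟨μ, hμ, hμT⟩ := h.exists_state x
  rw [← hμT]
  exact hμ.abs_le hf

theorem boundedComp (φ : X → X) : IsMarkov (boundedComp φ) := ⟨fun _ hf x => hf (φ x), rfl⟩

/-- The sum telescopes to `f - T ^ (n + 1) f`. -/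
theorem average_sub_apply (h : IsMarkov T) (n : ℕ) (f : lp (fun _ : X => ℝ) ∞) (x : X) :
    |((n + 1 : ℝ)⁻¹ • ∑ i ∈ Finset.range (n + 1), T ^ i) (f - T f) x| ≤ 2 * ‖f‖ / (n + 1) := by
  have h1 : (∑ i ∈ Finset.range (n + 1), T ^ i) (f - T f) = f - (T ^ (n + 1)) f := by
    have := congrArg (fun A => A f) (geom_sum_mul_neg T (n + 1))
    simpa using this
  have hf := fun x => lp.norm_apply_le_norm ENNReal.top_ne_zero f x
  have h2 : |f x| ≤ ‖f‖ := hf x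
  have h3 : |(T ^ (n + 1)) f x| ≤ ‖f‖ := (h.pow (n + 1)).abs_le hf x
  rw [LinearMap.smul_apply, h1, lp.coeFn_smul, Pi.smul_apply, smul_eq_mul, abs_mul,
    abs_of_nonneg (by positivity), lp.coeFn_sub, Pi.sub_apply, inv_mul_eq_div]
  gcongr
  exact (abs_sub _ _).trans (by linarith)

end IsMarkov

/-- Long averages of translation by `g` make `f - g · f` uniformly small. For a sum of such terms
the averages are composed: they commute and do not increase the sup norm, so each estimate survives.
-/
theorem IsAmenable.of_comm {G : Type u} [Group G] (h : ∀ a b : G, a * b = b * a) :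
    IsAmenable G := by
  let τ : G → Module.End ℝ (lp (fun _ : G => ℝ) ∞) := fun g => boundedComp (g⁻¹ * ·)
  have hτ : ∀ a ∈ Set.range τ, ∀ b ∈ Set.range τ, a * b = b * a := by
    rintro _ ⟨a, rfl⟩ _ ⟨b, rfl⟩
    refine LinearMap.ext fun f => lp.ext (funext fun x => congrArg f ?_)
    change b⁻¹ * (a⁻¹ * x) = a⁻¹ * (b⁻¹ * x)
    rw [← mul_assoc, h b⁻¹, mul_assoc]
  let A := Algebra.adjoin ℝ (Set.range τ)
  have hA : ∀ a ∈ A, ∀ b ∈ A, a * b = b * a := fun a ha b hb =>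
    congrArg Subtype.val ((Algebra.isMulCommutative_adjoin ℝ hτ).is_comm.comm ⟨a, ha⟩ ⟨b, hb⟩)
  refine isAmenable_of_states fun d hd => ?_
  suffices hsmall : ∀ ε > 0, ∃ T ∈ A, IsMarkov T ∧ ∀ x, |T d x| ≤ ε by
    intro ε hε
    obtain ⟨T, -, hT, hle⟩ := hsmall (ε / 2) (by positivity)
    obtain ⟨μ, hμ, hμT⟩ := hT.exists_state 1
    refine ⟨μ, hμ, ?_⟩
    have := (_root_.abs_le.1 (hle 1)).2
    rw [hμT]
    linarith
  refine Submodule.span_induction ?_ ?_ ?_ ?_ hd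
  · rintro _ ⟨g, -, f, rfl⟩ ε hε
    obtain ⟨n, hn⟩ := exists_nat_gt (2 * ‖f‖ / ε)
    have hg : IsMarkov (τ g) := IsMarkov.boundedComp _
    refine ⟨_, A.smul_mem (A.sum_mem fun i _ => A.pow_mem
      (Algebra.subset_adjoin ⟨g, rfl⟩) i) _, hg.average n, fun x => ?_⟩
    refine (hg.average_sub_apply n f x).trans ?_
    rw [div_lt_iff₀ hε] at hn
    rw [div_le_iff₀ (by positivity)]
    linarith
  · exact fun ε hε => ⟨1, A.one_mem, IsMarkov.one, fun x => by simpa using hε.le⟩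
  · intro d e _ _ hd he ε hε
    obtain ⟨T, hTA, hT, hTd⟩ := hd (ε / 2) (by positivity)
    obtain ⟨U, hUA, hU, hUe⟩ := he (ε / 2) (by positivity)
    refine ⟨T * U, A.mul_mem hTA hUA, hT.mul hU, fun x => ?_⟩
    have h1 : |(T * U) d x| ≤ ε / 2 := by
      rw [hA T hTA U hUA]
      exact hU.abs_le hTd x
    have h2 : |(T * U) e x| ≤ ε / 2 := hT.abs_le hUe x
    rw [map_add, lp.coeFn_add, Pi.add_apply]
    exact (abs_add_le _ _).trans (by linarith)
  · intro c d _ hd ε hε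
    obtain ⟨T, hTA, hT, hTd⟩ := hd (ε / (|c| + 1)) (by positivity)
    refine ⟨T, hTA, hT, fun x => ?_⟩
    rw [map_smul, lp.coeFn_smul, Pi.smul_apply, smul_eq_mul, abs_mul]
    calc |c| * |T d x| ≤ (|c| + 1) * (ε / (|c| + 1)) := by
          gcongr
          · linarith
          · exact hTd x
      _ = ε := by field_simp

end Amenability

/-! ### Extension closed classes -/

section Embedding

open Filter
open scoped commutatorElement

/-- Classes of groups that contain the abelian groups and are closed under subgroups, extensions
and direct unions. -/
structure IsExtensionClosedClass (C : (G : Type u) → [Group G] → Prop) : Prop where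
  of_comm : ∀ (G : Type u) [Group G], (∀ a b : G, a * b = b * a) → C G
  of_injective : ∀ (G K : Type u) [Group G] [Group K] (φ : K →* G), Function.Injective φ → C G → C K
  of_extension : ∀ (G : Type u) [Group G] (N : Subgroup G) [N.Normal], C N → C (G ⧸ N) → C G
  of_directedUnion : ∀ (G : Type u) [Group G] (S : Set (Subgroup G)), DirectedOn (· ≤ ·) S →
    (∀ K ∈ S, C K) → (∀ g : G, ∃ K ∈ S, g ∈ K) → C G

theorem isExtensionClosedClass_isElementaryAmenable :
    IsExtensionClosedClass.{u} IsElementaryAmenable where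
  of_comm G _ h := .of_comm G h
  of_injective G K _ _ φ hφ h := .of_injective G K φ hφ h
  of_extension G _ N _ hN hQ := .of_extension G N hN hQ
  of_directedUnion G _ S hdir hS hunion := .of_directedUnion G S hdir hS hunion

theorem isExtensionClosedClass_isAmenable : IsExtensionClosedClass.{u} IsAmenable where
  of_comm _ _ h := .of_comm h
  of_injective _ _ _ _ φ hφ h := .of_injective φ hφ h
  of_extension _ _ N _ hN hQ := .of_extension N hN hQ
  of_directedUnion _ _ S hdir hS hunion := .of_directedUnion S hdir hS hunion

namespace IsExtensionClosedClass

variable {C : (G : Type u) → [Group G] → Prop}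

theorem of_ker (hC : IsExtensionClosedClass C) {G Q : Type u} [Group G] [Group Q] (π : G →* Q)
    (hK : C π.ker) (hQ : C Q) : C G :=
  hC.of_extension G π.ker hK <| hC.of_injective Q _ (QuotientGroup.kerLift π)
    (QuotientGroup.kerLift_injective π) hQ

/-- The quotient by the kernel embeds in `Q`, hence is abelian. `Q` may lie in another universe, as
ℤ does below. -/
theorem of_ker_of_commutator_le (hC : IsExtensionClosedClass C) {G : Type u} {Q : Type*} [Group G]
    [Group Q] (π : G →* Q) (hK : C π.ker) (hπ : ∀ a b, π a * π b = π b * π a) : C G := by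
  refine hC.of_extension G π.ker hK (hC.of_comm _ fun a b => ?_)
  apply QuotientGroup.kerLift_injective π
  induction a using QuotientGroup.induction_on with | H a => ?_
  induction b using QuotientGroup.induction_on with | H b => ?_
  simpa using hπ a b

/-- Evaluation at one point of `s` maps to `K`, and its kernel has smaller support. -/
theorem of_finset_support (hC : IsExtensionClosedClass C) {ι : Type*} {K : Type u} [Group K]
    (hK : C K) (s : Finset ι) :
    ∀ (B : Type u) [Group B] (θ : B →* (ι → K)), Function.Injective θ →
      (∀ b, ∀ i ∉ s, θ b i = 1) → C B := by
  classical
  induction s using Finset.induction_on with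
  | empty =>
    intro B _ θ hθ h
    exact hC.of_comm B fun a b => hθ <| by
      rw [show θ (a * b) = 1 from funext fun i => h _ i (by simp),
        show θ (b * a) = 1 from funext fun i => h _ i (by simp)]
  | insert i s _ ih =>
    intro B _ θ hθ h
    refine hC.of_ker ((Pi.evalMonoidHom _ i).comp θ) ?_ hK
    refine ih _ (θ.comp (Subgroup.subtype _)) (hθ.comp Subtype.val_injective) fun b j hj => ?_
    by_cases hji : j = i
    · subst hji
      exact b.2
    · exact h _ j (by simp [hji, hj])

/-- A group of finitely supported functions into a group in the class is in the class. -/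
theorem of_eventually_cofinite (hC : IsExtensionClosedClass C) {ι : Type*} {K : Type u} [Group K]
    (hK : C K) {B : Type u} [Group B] (θ : B →* (ι → K)) (hθ : Function.Injective θ)
    (h : ∀ b, θ b =ᶠ[cofinite] 1) : C B := by
  classical
  let P : Finset ι → Subgroup B := fun s =>
    { carrier := {b | ∀ i ∉ s, θ b i = 1}
      one_mem' := fun i _ => by simp
      mul_mem' := fun ha hb i hi => by simp [ha i hi, hb i hi]
      inv_mem' := fun ha i hi => by simp [ha i hi] }
  have hmono : Monotone P := fun s t hst b hb i hi => hb i fun his => hi (hst his)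
  refine hC.of_directedUnion B (Set.range P) (directedOn_range.2 hmono.directed_le) ?_ fun b => ?_
  · rintro _ ⟨s, rfl⟩
    exact hC.of_finset_support hK s _ (θ.comp (Subgroup.subtype _))
      (hθ.comp Subtype.val_injective) fun b => b.2
  · have hfin : {i | θ b i ≠ 1}.Finite := h b
    refine ⟨_, ⟨hfin.toFinset, rfl⟩, fun i hi => ?_⟩
    simpa using hi

end IsExtensionClosedClass

/-! ### Wreath products with ℤ and commutators -/

namespace RegularWreathProduct

variable {D Q : Type*} [Group D] [Group Q]

/-- The projection to functions on the base of a wreath product. -/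
def leftHom (S : Subgroup (D ≀ᵣ Q)) (hS : ∀ x ∈ S, x.right = 1) : S →* (Q → D) where
  toFun x := x.1.left
  map_one' := rfl
  map_mul' x y := by
    funext q
    simp [hS x.1 x.2]

theorem leftHom_injective (S : Subgroup (D ≀ᵣ Q)) (hS : ∀ x ∈ S, x.right = 1) :
    Function.Injective (leftHom S hS) := fun x y h =>
  Subtype.ext (RegularWreathProduct.ext h ((hS x.1 x.2).trans (hS y.1 y.2).symm))

/-- The base of a wreath product. -/
def base : (Q → D) →* D ≀ᵣ Q where
  toFun f := ⟨f, 1⟩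
  map_one' := rfl
  map_mul' f g := by ext <;> simp

@[simp] theorem base_left (f : Q → D) : (base f).left = f := rfl

@[simp] theorem base_right (f : Q → D) : (base f).right = 1 := rfl

theorem base_injective : Function.Injective (base : (Q → D) →* D ≀ᵣ Q) := fun _ _ h =>
  congrArg RegularWreathProduct.left h

theorem inl_mul_base_mul_inv (q : Q) (f : Q → D) :
    inl q * base f * (inl q)⁻¹ = base fun x => f (q⁻¹ * x) := by
  ext <;> simp

end RegularWreathProduct

open RegularWreathProduct

/-- The elements of `H ≀ᵣ ℤ` whose left part is trivial near `-∞` and constant near `∞`. -/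
def stepSubgroup (H : Type*) [Group H] : Subgroup (H ≀ᵣ Multiplicative ℤ) where
  carrier := {x | (∀ᶠ n : ℤ in atBot, x.left (.ofAdd n) = 1) ∧
    ∃ c, ∀ᶠ n : ℤ in atTop, x.left (.ofAdd n) = c}
  one_mem' := ⟨by simp, 1, by simp⟩
  mul_mem' := by
    rintro x y ⟨hx, c, hc⟩ ⟨hy, d, hd⟩
    refine ⟨?_, c * d, ?_⟩
    · filter_upwards [hx, (tendsto_atBot_add_const_left atBot (-x.right.toAdd)
        tendsto_id).eventually hy] with n hn hn'
      change x.left _ * y.left _ = 1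
      rw [hn, one_mul]
      exact hn'
    · filter_upwards [hc, (tendsto_atTop_add_const_left atTop (-x.right.toAdd)
        tendsto_id).eventually hd] with n hn hn'
      change x.left _ * y.left _ = _
      rw [hn]
      exact congrArg _ hn'
  inv_mem' := by
    rintro x ⟨hx, c, hc⟩
    refine ⟨?_, c⁻¹, ?_⟩
    · filter_upwards [(tendsto_atBot_add_const_left atBot x.right.toAdd
        tendsto_id).eventually hx] with n hn
      exact inv_eq_one.2 hn
    · filter_upwards [(tendsto_atTop_add_const_left atTop x.right.toAdd
        tendsto_id).eventually hc] with n hn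
      exact congrArg _ hn

/-- There are three layers: the shift in ℤ, the limit at `∞` in `H`, and finitely supported
functions. -/
theorem IsExtensionClosedClass.stepSubgroup {C : (G : Type u) → [Group G] → Prop}
    (hC : IsExtensionClosedClass C) {H : Type u} [Group H] (hH : C H) : C (stepSubgroup H) := by
  let K := _root_.stepSubgroup H
  let K₀ : Subgroup (H ≀ᵣ Multiplicative ℤ) := K ⊓ rightHom.ker
  have hK₀ : ∀ x ∈ K₀, x.right = 1 := fun x hx => hx.2
  -- Germs at `∞` make the limit a homomorphism: on `K₀` every germ is constant, and `const` is
  -- injective.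
  let germ : K₀ →* Germ (Filter.map Multiplicative.ofAdd (atTop : Filter ℤ)) H :=
    (Germ.coeMulHom _).comp (leftHom K₀ hK₀)
  let const : H →* Germ (Filter.map Multiplicative.ofAdd (atTop : Filter ℤ)) H :=
    (Germ.coeMulHom _).comp (Pi.constMonoidHom _ H)
  have hconst : Function.Injective const := fun a b h => by
    obtain ⟨n, hn⟩ := (Filter.eventually_map.1 (Germ.coe_eq.1 h)).exists
    exact hn
  have hgerm : ∀ x, germ x ∈ const.range := fun x => by
    obtain ⟨-, c, hc⟩ := x.2.1
    exact ⟨c, Germ.coe_eq.2 (Filter.eventually_map.2 (hc.mono fun n hn => hn.symm))⟩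
  have hCK₀ : C K₀ := by
    let lim : K₀ →* H :=
      (MonoidHom.ofInjective hconst).symm.toMonoidHom.comp (germ.codRestrict _ hgerm)
    refine hC.of_ker lim ?_ hH
    refine hC.of_eventually_cofinite hH
      ((leftHom K₀ hK₀).comp lim.ker.subtype)
      ((leftHom_injective K₀ hK₀).comp Subtype.val_injective) fun x => ?_
    have h1 : germ x.1 = 1 := by
      have h2 : lim x.1 = 1 := x.2
      have h3 : germ.codRestrict _ hgerm x.1 = 1 :=
        (MulEquiv.map_eq_one_iff (MonoidHom.ofInjective hconst).symm).1 h2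
      exact congrArg Subtype.val h3
    have h4 : ∀ᶠ n : ℤ in atTop, x.1.1.left (.ofAdd n) = 1 :=
      Filter.eventually_map.1 (Germ.coe_eq.1 h1)
    have h5 : ∀ᶠ n : ℤ in cofinite, x.1.1.left (.ofAdd n) = 1 := by
      rw [Int.cofinite_eq]
      exact Filter.eventually_sup.2 ⟨x.1.2.1.1, h4⟩
    exact h5
  let π : K →* Multiplicative ℤ := rightHom.comp K.subtype
  refine hC.of_ker_of_commutator_le π ?_ fun a b => mul_comm _ _
  refine hC.of_injective K₀ π.ker
    ((K.subtype.comp π.ker.subtype).codRestrict K₀ fun x => ⟨x.1.2, x.2⟩) (fun x y h => ?_) hCK₀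
  have h' := congrArg Subtype.val h
  exact Subtype.ext (Subtype.ext h')

/-- Every group in the class embeds in a group in the class so that all its elements become
commutators with a common element. -/
theorem IsExtensionClosedClass.exists_commutator_embedding
    {C : (G : Type u) → [Group G] → Prop} (hC : IsExtensionClosedClass C) {H : Type u} [Group H]
    (hH : C H) : ∃ (K : Type u) (_ : Group K), C K ∧ ∃ (δ : H →* K) (a : H → K) (s : K),
      Function.Injective δ ∧ ∀ h, δ h = ⁅a h, s⁆ := by
  classical
  let δ₀ : H →* H ≀ᵣ Multiplicative ℤ := base.comp (MonoidHom.mulSingle (fun _ => H) 1)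
  have hδ₀ : ∀ h, δ₀ h ∈ _root_.stepSubgroup H := fun h => by
    refine ⟨?_, 1, ?_⟩
    · filter_upwards [eventually_lt_atBot 0] with n hn
      exact Pi.mulSingle_eq_of_ne (M := fun _ => H) (i := (1 : Multiplicative ℤ))
        (ne_of_lt hn : n ≠ 0) h
    · filter_upwards [eventually_gt_atTop 0] with n hn
      exact Pi.mulSingle_eq_of_ne (M := fun _ => H) (i := (1 : Multiplicative ℤ))
        (ne_of_gt hn : n ≠ 0) h
  -- The step function of height `h` on `[0, ∞)`; it differs from its shift by one only at 0.
  let a₀ : H → Multiplicative ℤ → H := fun h n => if 0 ≤ n.toAdd then h else 1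
  have ha₀ : ∀ h, base (a₀ h) ∈ _root_.stepSubgroup H := fun h => by
    refine ⟨?_, h, ?_⟩
    · filter_upwards [eventually_lt_atBot 0] with n hn
      exact if_neg hn.not_ge
    · filter_upwards [eventually_ge_atTop 0] with n hn
      exact if_pos hn
  let s₀ : H ≀ᵣ Multiplicative ℤ := inl (.ofAdd 1)
  have hs₀ : s₀ ∈ _root_.stepSubgroup H := ⟨by simp [s₀], 1, by simp [s₀]⟩
  refine ⟨_root_.stepSubgroup H, inferInstance, hC.stepSubgroup hH,
    δ₀.codRestrict _ hδ₀, fun h => ⟨_, ha₀ h⟩, ⟨s₀, hs₀⟩, fun x y h => ?_, fun h => ?_⟩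
  · exact Pi.mulSingle_injective (M := fun _ => H) (1 : Multiplicative ℤ)
      (base_injective (congrArg Subtype.val h))
  · apply Subtype.ext
    change base _ = base _ * s₀ * (base (a₀ h))⁻¹ * s₀⁻¹
    rw [← map_inv, mul_assoc, mul_assoc, ← mul_assoc s₀, inl_mul_base_mul_inv, ← map_mul]
    congr 1
    funext n
    induction n using Multiplicative.rec with | ofAdd n => ?_
    change Pi.mulSingle (M := fun _ => H) (1 : Multiplicative ℤ) h _ =
      (if 0 ≤ n then h else 1) * (if 0 ≤ -1 + n then h else 1)⁻¹
    rcases lt_trichotomy n 0 with hn | rfl | hn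
    · rw [Pi.mulSingle_eq_of_ne (show Multiplicative.ofAdd n ≠ 1 from ne_of_lt hn),
        if_neg (by lia), if_neg (by lia), inv_one, mul_one]
    · rw [if_pos le_rfl, if_neg (by lia), inv_one, mul_one]
      exact Pi.mulSingle_eq_same (M := fun _ => H) (1 : Multiplicative ℤ) h
    · rw [Pi.mulSingle_eq_of_ne (show Multiplicative.ofAdd n ≠ 1 from ne_of_gt hn),
        if_pos (by lia), if_pos (by lia), mul_inv_cancel]

/-! ### Sparse functions and the finitely generated group -/

theorem int_three_pow_sidon {a b c d : ℕ} (hab : a ≠ b)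
    (h : (3 : ℤ) ^ a - 3 ^ b = 3 ^ c - 3 ^ d) : a = c ∧ b = d := by
  -- The largest power dominates: if `c < a`, the left side is at least `2 * 3 ^ (a - 1)`, while the
  -- right side is below `3 ^ (a - 1)`.
  have key : ∀ a b c d : ℕ, b < a → (3 : ℤ) ^ a - 3 ^ b = 3 ^ c - 3 ^ d → a ≤ c := by
    intro a b c d hba h
    by_contra! hca
    obtain ⟨a, rfl⟩ : ∃ k, a = k + 1 := ⟨a - 1, by lia⟩
    have h1 : (3 : ℤ) ^ b ≤ 3 ^ a := pow_le_pow_right₀ (by norm_num) (by lia)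
    have h2 : (3 : ℤ) ^ c ≤ 3 ^ a := pow_le_pow_right₀ (by norm_num) (by lia)
    have h3 : (0 : ℤ) < 3 ^ d := by positivity
    have h4 : (0 : ℤ) < 3 ^ a := by positivity
    rw [pow_succ] at h
    lia
  have main : ∀ a b c d : ℕ, b < a → (3 : ℤ) ^ a - 3 ^ b = 3 ^ c - 3 ^ d → a = c ∧ b = d := by
    intro a b c d hba h
    have hdc : d < c := by
      have : (3 : ℤ) ^ b < 3 ^ a := pow_lt_pow_right₀ (by norm_num) hba
      exact (pow_lt_pow_iff_right₀ (by norm_num : (1 : ℤ) < 3)).1 (by linarith)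
    have hac : a = c := (key a b c d hba h).antisymm (key c d a b hdc h.symm)
    subst hac
    exact ⟨rfl, Nat.pow_right_injective (by norm_num : 2 ≤ 3) (by zify; linarith)⟩
  rcases hab.lt_or_gt with hab | hab
  · exact (main b a d c hab (by linarith)).symm
  · exact main a b c d hab h

section Spread

variable {K : Type*} [Group K] (k : ℕ → K)

open Classical in
/-- The function on `ℤ` with value `k i` at `3 ^ i` and trivial elsewhere. -/
noncomputable def spread (n : Multiplicative ℤ) : K :=
  if h : ∃ i : ℕ, (3 : ℤ) ^ i = n.toAdd then k h.choose else 1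

open Classical in
theorem spread_pow (i : ℕ) : spread k (.ofAdd (3 ^ i)) = k i := by
  have h : ∃ j : ℕ, (3 : ℤ) ^ j = 3 ^ i := ⟨i, rfl⟩
  have hi : h.choose = i := pow_right_injective₀ (by norm_num : (0 : ℤ) < 3) (by norm_num)
    h.choose_spec
  change dite (∃ j : ℕ, (3 : ℤ) ^ j = 3 ^ i) _ _ = _
  rw [dif_pos h, hi]

theorem exists_of_spread_ne_one {n : Multiplicative ℤ} (h : spread k n ≠ 1) :
    ∃ i : ℕ, (3 : ℤ) ^ i = n.toAdd := by
  by_contra hcon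
  exact h (dif_neg hcon)

/-- The translate of `spread k` by `q`. -/
noncomputable def spreadTranslate (q n : Multiplicative ℤ) : K := spread k (q⁻¹ * n)

/-- A common support point is `p + 3 ^ a = q + 3 ^ b` in additive notation, and `q - p = 3 ^ a - 3 ^
b` determines `a`. -/
theorem eq_of_spreadTranslate_ne_one {p q m n : Multiplicative ℤ} (hpq : p ≠ q)
    (h₁ : spreadTranslate k p m ≠ 1) (h₂ : spreadTranslate k q m ≠ 1)
    (h₃ : spreadTranslate k p n ≠ 1) (h₄ : spreadTranslate k q n ≠ 1) : m = n := by
  obtain ⟨a, ha⟩ := exists_of_spread_ne_one k h₁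
  obtain ⟨b, hb⟩ := exists_of_spread_ne_one k h₂
  obtain ⟨c, hc⟩ := exists_of_spread_ne_one k h₃
  obtain ⟨d, hd⟩ := exists_of_spread_ne_one k h₄
  simp only [toAdd_mul, toAdd_inv] at ha hb hc hd
  have hab : a ≠ b := by
    rintro rfl
    exact hpq (Multiplicative.toAdd.injective (by lia))
  obtain ⟨rfl, rfl⟩ := int_three_pow_sidon (c := c) (d := d) hab (by lia)
  exact Multiplicative.toAdd.injective (by lia)

theorem commutator_spreadTranslate_apply {p q m n : Multiplicative ℤ} (hpq : p ≠ q)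
    (h₁ : spreadTranslate k p m ≠ 1) (h₂ : spreadTranslate k q m ≠ 1) (hn : n ≠ m) :
    ⁅spreadTranslate k p, spreadTranslate k q⁆ n = 1 := by
  change ⁅spreadTranslate k p n, spreadTranslate k q n⁆ = 1
  by_cases h₃ : spreadTranslate k p n = 1
  · rw [h₃, commutatorElement_one_left]
  by_cases h₄ : spreadTranslate k q n = 1
  · rw [h₄, commutatorElement_one_right]
  exact absurd (eq_of_spreadTranslate_ne_one k hpq h₃ h₄ h₁ h₂) hn

theorem commutator_spreadTranslate_eventuallyEq (p q : Multiplicative ℤ) :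
    ⁅spreadTranslate k p, spreadTranslate k q⁆ =ᶠ[cofinite] 1 := by
  by_cases hpq : p = q
  · rw [hpq, commutatorElement_self]
  refine Set.Subsingleton.finite fun m hm n hn => ?_
  have hne : ∀ m : Multiplicative ℤ, ⁅spreadTranslate k p, spreadTranslate k q⁆ m ≠ 1 →
      spreadTranslate k p m ≠ 1 ∧ spreadTranslate k q m ≠ 1 := fun m hm =>
    ⟨fun h => hm (by
      change ⁅spreadTranslate k p m, spreadTranslate k q m⁆ = 1
      rw [h, commutatorElement_one_left]), fun h => hm (by
      change ⁅spreadTranslate k p m, spreadTranslate k q m⁆ = 1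
      rw [h, commutatorElement_one_right])⟩
  exact eq_of_spreadTranslate_ne_one k hpq (hne m hm).1 (hne m hm).2 (hne n hn).1 (hne n hn).2

/-- The subgroup of `K ≀ᵣ ℤ` generated by `spread k` and the shift. -/
noncomputable def spreadGroup : Subgroup (K ≀ᵣ Multiplicative ℤ) :=
  Subgroup.closure {base (spread k), inl (.ofAdd 1)}

theorem spreadGroup_fg : Group.FG (spreadGroup k) :=
  Group.closure_finite_fg _

theorem inl_mem_spreadGroup (q : Multiplicative ℤ) : inl q ∈ spreadGroup k := by
  have h : (inl (.ofAdd 1) : K ≀ᵣ Multiplicative ℤ) ∈ spreadGroup k :=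
    Subgroup.subset_closure (by simp)
  have h1 : q = Multiplicative.ofAdd (1 : ℤ) ^ q.toAdd := by
    rw [← ofAdd_zsmul, smul_eq_mul, mul_one, ofAdd_toAdd]
  rw [h1, map_zpow]
  exact zpow_mem h _

theorem base_spreadTranslate_mem_spreadGroup (q : Multiplicative ℤ) :
    base (spreadTranslate k q) ∈ spreadGroup k := by
  have h : base (spread k) ∈ spreadGroup k := Subgroup.subset_closure (by simp)
  have h1 := mul_mem (mul_mem (inl_mem_spreadGroup k q) h) (inv_mem (inl_mem_spreadGroup k q))
  rwa [inl_mul_base_mul_inv] at h1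

theorem base_mulSingle_mem_spreadGroup (i : ℕ) (hi : i ≠ 0) :
    base (Pi.mulSingle 1 ⁅k i, k 0⁆) ∈ spreadGroup k := by
  by_cases hki : k i = 1
  · rw [hki, commutatorElement_one_left, Pi.mulSingle_one, map_one]
    exact one_mem _
  by_cases hk0 : k 0 = 1
  · rw [hk0, commutatorElement_one_right, Pi.mulSingle_one, map_one]
    exact one_mem _
  -- Translation by `-3 ^ j` brings the value `k j` to the origin, so the translates for `i` and 0
  -- meet exactly there.
  let e : ℕ → Multiplicative ℤ := fun j => .ofAdd (-3 ^ j)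
  have he : ∀ j, spreadTranslate k (e j) 1 = k j := fun j => by
    rw [← spread_pow k j, spreadTranslate, mul_one]
    congr 1
    simp [e]
  have hne : e i ≠ e 0 := fun h => hi <|
    pow_right_injective₀ (by norm_num : (0 : ℤ) < 3) (by norm_num)
      (neg_injective (Multiplicative.ofAdd.injective h))
  have h : ⁅base (spreadTranslate k (e i)), base (spreadTranslate k (e 0))⁆ ∈ spreadGroup k := by
    rw [commutatorElement_def]
    have h1 := base_spreadTranslate_mem_spreadGroup k (e i)
    have h2 := base_spreadTranslate_mem_spreadGroup k (e 0)
    exact mul_mem (mul_mem (mul_mem h1 h2) (inv_mem h1)) (inv_mem h2)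
  rw [← map_commutatorElement] at h
  convert h using 2
  funext n
  by_cases hn : n = 1
  · subst hn
    rw [Pi.mulSingle_eq_same, ← he i, ← he 0]
    rfl
  · rw [Pi.mulSingle_eq_of_ne hn, commutator_spreadTranslate_apply k hne (m := 1) _ _ hn]
    · rwa [he]
    · rwa [he]

/-- Products and inverses in the wreath product only shift left parts, and the closure of the
translates is shift invariant. -/
theorem left_mem_closure_of_mem_spreadGroup {x : K ≀ᵣ Multiplicative ℤ} (hx : x ∈ spreadGroup k) :
    x.left ∈ Subgroup.closure (Set.range (spreadTranslate k)) := by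
  set A := Subgroup.closure (Set.range (spreadTranslate k)) with hA
  have hshift : ∀ (q : Multiplicative ℤ), ∀ f ∈ A, (fun n => f (q * n)) ∈ A := by
    intro q f hf
    let σ : (Multiplicative ℤ → K) →* (Multiplicative ℤ → K) :=
      { toFun f n := f (q * n)
        map_one' := rfl
        map_mul' _ _ := rfl }
    suffices h : A ≤ A.comap σ from h hf
    rw [hA, Subgroup.closure_le]
    rintro _ ⟨p, rfl⟩
    refine Subgroup.subset_closure ⟨q⁻¹ * p, ?_⟩
    funext n
    change spread k _ = spread k _
    congr 1
    rw [mul_inv_rev, inv_inv, mul_assoc]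
  refine Subgroup.closure_induction (p := fun x _ => x.left ∈ A) ?_ ?_ ?_ ?_ hx
  · rintro _ (rfl | rfl)
    · refine Subgroup.subset_closure ⟨1, ?_⟩
      funext n
      simp [spreadTranslate]
    · exact one_mem A
  · exact one_mem A
  · exact fun x y _ _ hx hy => mul_mem hx (hshift _ _ hy)
  · exact fun x _ hx => hshift _ _ (inv_mem hx)

/-- Translates of `spread k` commute up to finite support, so their germs along `cofinite` generate
an abelian group. -/
theorem germ_left_commute {x y : K ≀ᵣ Multiplicative ℤ} (hx : x ∈ spreadGroup k)
    (hy : y ∈ spreadGroup k) :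
    Commute (Germ.coeMulHom cofinite x.left) (Germ.coeMulHom cofinite y.left) := by
  have hcomm : IsMulCommutative
      (Subgroup.closure (Germ.coeMulHom cofinite '' Set.range (spreadTranslate k))) := by
    refine Subgroup.isMulCommutative_closure ?_
    rintro _ ⟨_, ⟨p, rfl⟩, rfl⟩ _ ⟨_, ⟨q, rfl⟩, rfl⟩
    rw [← commutatorElement_eq_one_iff_mul_comm, ← map_commutatorElement]
    exact Germ.coe_eq.2 (commutator_spreadTranslate_eventuallyEq k p q)
  rw [← MonoidHom.map_closure] at hcomm
  exact congrArg Subtype.val (hcomm.is_comm.comm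
    ⟨_, Subgroup.mem_map_of_mem _ (left_mem_closure_of_mem_spreadGroup k hx)⟩
    ⟨_, Subgroup.mem_map_of_mem _ (left_mem_closure_of_mem_spreadGroup k hy)⟩)

end Spread

/-- The layers are the shift in ℤ, an abelian group of germs, and finitely supported functions into
`K`. -/
theorem IsExtensionClosedClass.spreadGroup {C : (G : Type u) → [Group G] → Prop}
    (hC : IsExtensionClosedClass C) {K : Type u} [Group K] (hK : C K) (k : ℕ → K) :
    C (spreadGroup k) := by
  let G := _root_.spreadGroup k
  let G₀ : Subgroup (K ≀ᵣ Multiplicative ℤ) := G ⊓ rightHom.ker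
  have hG₀ : ∀ x ∈ G₀, x.right = 1 := fun x hx => hx.2
  have hCG₀ : C G₀ := by
    let germ : G₀ →* Germ (cofinite : Filter (Multiplicative ℤ)) K :=
      (Germ.coeMulHom _).comp (leftHom G₀ hG₀)
    refine hC.of_ker_of_commutator_le germ ?_ fun a b => germ_left_commute k a.2.1 b.2.1
    exact hC.of_eventually_cofinite hK ((leftHom G₀ hG₀).comp germ.ker.subtype)
      ((leftHom_injective G₀ hG₀).comp Subtype.val_injective) fun x => Germ.coe_eq.1 x.2
  let π : G →* Multiplicative ℤ := rightHom.comp G.subtype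
  refine hC.of_ker_of_commutator_le π ?_ fun a b => mul_comm _ _
  refine hC.of_injective G₀ π.ker
    ((G.subtype.comp π.ker.subtype).codRestrict G₀ fun x => ⟨x.1.2, x.2⟩) (fun x y h => ?_) hCG₀
  have h' := congrArg Subtype.val h
  exact Subtype.ext (Subtype.ext h')

/-- A countable group in an extension closed class embeds in a finitely generated group in the
class. -/
theorem IsExtensionClosedClass.exists_fg_embedding {C : (G : Type u) → [Group G] → Prop}
    (hC : IsExtensionClosedClass C) (H : Type u) [Group H] [Countable H] (hH : C H) :
    ∃ (G : Type u) (_ : Group G), Group.FG G ∧ C G ∧ ∃ φ : H →* G, Function.Injective φ := by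
  classical
  obtain ⟨K, _, hK, δ, a, s, hδ, hδa⟩ := hC.exists_commutator_embedding hH
  obtain ⟨e, he⟩ := exists_surjective_nat H
  -- Index 0 holds the common element `s`, so `⁅k (i + 1), k 0⁆ = δ (e i)`.
  let k : ℕ → K := fun n => Nat.casesOn n s fun i => a (e i)
  let φ : H →* K ≀ᵣ Multiplicative ℤ := base.comp ((MonoidHom.mulSingle (fun _ => K) 1).comp δ)
  have hφ : ∀ h, φ h ∈ _root_.spreadGroup k := fun h => by
    obtain ⟨i, rfl⟩ := he h
    have := base_mulSingle_mem_spreadGroup k (i + 1) i.succ_ne_zero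
    change base (Pi.mulSingle 1 (δ (e i))) ∈ _
    rw [hδa]
    exact this
  refine ⟨_root_.spreadGroup k, inferInstance, spreadGroup_fg k, hC.spreadGroup hK k,
    φ.codRestrict _ hφ, fun x y h => hδ ?_⟩
  exact Pi.mulSingle_injective (M := fun _ => K) (1 : Multiplicative ℤ)
    (base_injective (congrArg Subtype.val h))

end Embedding

theorem corollary1p3 :
    (∀ (H : Type u) [Group H] [Countable H], IsElementaryAmenable H →
      ∃ (G : Type u) (_ : Group G), Group.FG G ∧ IsElementaryAmenable G ∧
        ∃ φ : H →* G, Function.Injective φ) ∧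
    (∀ (H : Type u) [Group H] [Countable H], IsAmenable H →
      ∃ (G : Type u) (_ : Group G), Group.FG G ∧ IsAmenable G ∧
        ∃ φ : H →* G, Function.Injective φ) :=
  ⟨fun H _ _ hH => isExtensionClosedClass_isElementaryAmenable.exists_fg_embedding H hH,
    fun H _ _ hH => isExtensionClosedClass_isAmenable.exists_fg_embedding H hH⟩
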